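/- **Theorem (Strong normalisation of System I with $\eta$- and $\delta$-expansion).** *Types* are $A ::= \tau \mid A\Rightarrow A\mid A\wedge A$. Type equivalence $\equiv$ is the smallest congruence such that $A\wedge B\equiv B\wedge A$, $A\wedge(B\wedge C)\equiv(A\wedge B)\wedge C$, $A\Rightarrow(B\wedge C)\equiv(A\Rightarrow B)\wedge(A\Rightarrow C)$ and $(A\wedge B)\Rightarrow C\equiv A\Rightarrow B\Rightarrow C$. To every type $A$ is associated an infinite set of variables $\mathcal V_A$, with $\mathcal V_A=\mathcal V_B$ if $A\equiv B$ and $\mathcal V_A\cap\mathcal V_B=\varnothing$ otherwise. *Preterms*, taken modulo $\alpha$-equivalence, are $r ::= x\mid\lambda x.r\mid rr\mid r\times r\mid\pi_A(r)$; one writes $\lambda x^A.r$ for $\lambda x.r$ when $x\in\mathcal V_A$. *Eliminations* are applications and projections. The typing relation $r:A$ is defined inductively by: $x:A$ if $x\in\mathcal V_A$; if $r:A$ and $A\equiv B$ then $r:B$; if $r:B$ then $\lambda x^A.r:A\Rightarrow B$; if $r:A\Rightarrow B$ and $s:A$ then $rs:B$; if $r:A$ and $s:B$ then $r\times s:A\wedge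 B$; if $r:A\wedge B$ then $\pi_A(r):A$. Let $\rightleftarrows$ be the smallest symmetric contextually closed relation on preterms such that $r\times s\rightleftarrows s\times r$, $(r\times s)\times t\rightleftarrows r\times(s\times t)$, $\lambda x^A.(r\times s)\rightleftarrows\lambda x^A.r\times\lambda x^A.s$ and $rst\rightleftarrows r(s\times t)$, and let $\rightleftarrows^*$ be its reflexive-transitive closure. Let $\hookrightarrow_{\beta\pi\zeta}$ and $\hookrightarrow_{\eta\delta}$ be given by - $(\beta)$ $(\lambda x^A.r)s\hookrightarrow_{\beta\pi\zeta} r[s/x]$ if $s:A$; $(\pi)$ $\pi_A(r\times s)\hookrightarrow_{\beta\pi\zeta}r$ if $r:A$; $(\zeta)$ $(r\times s)t\hookrightarrow_{\beta\pi\zeta}rt\times st$; - $(\eta)$ $r\hookrightarrow_{\eta\delta}\lambda x^A.(rx)$ if $r:A\Rightarrow B$, $x$ is fresh and $r$ is an elimination or a variable; $(\delta)$ $r\hookrightarrow_{\eta\delta}\pi_A(r)\times\pi_B(r)$ if $r:A\wedge B$ and $r$ is an elimination or a variable. The relations $\hookrightarrow_{b}$ (no expansion at head position) and $\hookrightarrow$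 are defined by mutual induction: $r\hookrightarrow s$ if $r\hookrightarrow_{\eta\delta}s$ or $r\hookrightarrow_b s$; $r\hookrightarrow_b s$ if $r\hookrightarrow_{\beta\pi\zeta}s$; if $r\hookrightarrow s$ then $\lambda x.r\hookrightarrow_b\lambda x.s$, $tr\hookrightarrow_b ts$, $r\times t\hookrightarrow_b s\times t$ and $t\times r\hookrightarrow_b t\times s$; if $r\hookrightarrow_b s$ then $rt\hookrightarrow_b st$ and $\pi_A(r)\hookrightarrow_b\pi_A(s)$. Finally $r\rightsquigarrow s$ iff $r\rightleftarrows^* r'\hookrightarrow s'\rightleftarrows^* s$ for some $r',s'$. A preterm $r$ is *strongly normalising* if there is no infinite sequence $r\rightsquigarrow r_1\rightsquigarrow r_2\rightsquigarrow\cdots$. **Statement.** If $r:A$ for some type $A$, then $r$ is strongly normalising. -/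

import Mathlib

noncomputable section

namespace SystemI

/-! ## Types and type isomorphisms -/

/-- Types `A ::= τ | A ⇒ A | A ∧ A`. -/
inductive Ty : Type
  | atom : Ty
  | arr : Ty → Ty → Ty
  | conj : Ty → Ty → Ty

/-- Type equivalence: the smallest congruence containing the four isomorphisms. -/
inductive TyEquiv : Ty → Ty → Prop
  | comm (A B : Ty) : TyEquiv (.conj A B) (.conj B A)
  | asso (A B C : Ty) : TyEquiv (.conj A (.conj B C)) (.conj (.conj A B) C)
  | dist (A B C : Ty) : TyEquiv (.arr A (.conj B C)) (.conj (.arr A B) (.arr A C))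
  | curry (A B C : Ty) : TyEquiv (.arr (.conj A B) C) (.arr A (.arr B C))
  | refl (A : Ty) : TyEquiv A A
  | symm {A B : Ty} : TyEquiv A B → TyEquiv B A
  | trans {A B C : Ty} : TyEquiv A B → TyEquiv B C → TyEquiv A C
  | arr {A A' B B' : Ty} : TyEquiv A A' → TyEquiv B B' → TyEquiv (.arr A B) (.arr A' B')
  | conj {A A' B B' : Ty} : TyEquiv A A' → TyEquiv B B' → TyEquiv (.conj A B) (.conj A' B')

/-- The setoid of type equivalence. -/
def tySetoid : Setoid Ty where
  r := TyEquiv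
  iseqv := ⟨TyEquiv.refl, TyEquiv.symm, TyEquiv.trans⟩

/-- Types up to equivalence. -/
def TyClass : Type := Quotient tySetoid

/-- The class of a type; `cls A = cls B` holds exactly when `A ≡ B`. -/
def cls (A : Ty) : TyClass := Quotient.mk tySetoid A

theorem cls_eq_iff {A B : Ty} : cls A = cls B ↔ TyEquiv A B :=
  ⟨fun h => Quotient.exact (s := tySetoid) h, fun h => Quotient.sound (s := tySetoid) h⟩

/-! ## Preterms

Every variable belongs to exactly one class of types, and there are infinitely many variables in
each class. Preterms are taken modulo α-equivalence, by means of de Bruijn indices that are counted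
separately in each class: `lam X r` binds the variable with index `0` of class `X` in `r`; the
occurrence `var X n` refers to the `n`-th enclosing binder *of class `X`* (binders of other classes
are not counted) if there is one, and otherwise it is a free variable. So the free variables
belonging to the type `A` are the `var (cls A) n`, `n : ℕ`. -/

/-- Preterms `r ::= x | λx.r | r r | r × r | π_A(r)` modulo α-equivalence. -/
inductive Preterm : Type
  | var : TyClass → ℕ → Preterm
  | lam : TyClass → Preterm → Preterm
  | app : Preterm → Preterm → Preterm
  | prod : Preterm → Preterm → Preterm
  | proj : Ty → Preterm → Preterm

namespace Preterm

open Classical in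
/-- A renaming of variables (preserving classes), carried under a binder of class `X`. -/
def upRen (X : TyClass) (ρ : TyClass → ℕ → ℕ) : TyClass → ℕ → ℕ := fun Y n =>
  if Y = X then
    match n with
    | 0 => 0
    | k + 1 => ρ Y k + 1
  else ρ Y n

/-- Simultaneous renaming of the free variables. -/
def rename : (TyClass → ℕ → ℕ) → Preterm → Preterm
  | ρ, var X n => var X (ρ X n)
  | ρ, lam X r => lam X (rename (upRen X ρ) r)
  | ρ, app r s => app (rename ρ r) (rename ρ s)
  | ρ, prod r s => prod (rename ρ r) (rename ρ s)
  | ρ, proj A r => proj A (rename ρ r)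

open Classical in
/-- The preterm `r`, placed under a new binder of class `X` whose variable is not free in `r`. -/
def shift (X : TyClass) (r : Preterm) : Preterm :=
  rename (fun Y n => if Y = X then n + 1 else n) r

open Classical in
/-- A substitution, carried under a binder of class `X`. -/
def up (X : TyClass) (σ : TyClass → ℕ → Preterm) : TyClass → ℕ → Preterm := fun Y n =>
  if Y = X then
    match n with
    | 0 => var Y 0
    | k + 1 => shift X (σ Y k)
  else shift X (σ Y n)

/-- Simultaneous capture-avoiding substitution. -/
def subst : (TyClass → ℕ → Preterm) → Preterm → Preterm
  | σ, var X n => σ X n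
  | σ, lam X r => lam X (subst (up X σ) r)
  | σ, app r s => app (subst σ r) (subst σ s)
  | σ, prod r s => prod (subst σ r) (subst σ s)
  | σ, proj A r => proj A (subst σ r)

open Classical in
/-- For the body `r` of `lam X r`, the preterm `r[s/x]`, where `x` is the bound variable. -/
def inst (X : TyClass) (s r : Preterm) : Preterm :=
  subst (fun Y n =>
    if Y = X then
      match n with
      | 0 => s
      | k + 1 => var Y k
    else var Y n) r

/-- Eliminations are the applications and the projections; this is the class of the preterms that
are an elimination or a variable. -/
inductive IsElimOrVar : Preterm → Prop
  | var (X : TyClass) (n : ℕ) : IsElimOrVar (var X n)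
  | app (r s : Preterm) : IsElimOrVar (app r s)
  | proj (A : Ty) (r : Preterm) : IsElimOrVar (proj A r)

end Preterm

open Preterm

/-! ## Typing -/

/-- The typing relation `r : A`. -/
inductive HasType : Preterm → Ty → Prop
  | ax (A : Ty) (n : ℕ) : HasType (var (cls A) n) A
  | conv {r : Preterm} {A B : Ty} : TyEquiv A B → HasType r A → HasType r B
  | arrI {r : Preterm} {A B : Ty} : HasType r B → HasType (lam (cls A) r) (.arr A B)
  | arrE {r s : Preterm} {A B : Ty} : HasType r (.arr A B) → HasType s A → HasType (app r s) B
  | conjI {r s : Preterm} {A B : Ty} :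
      HasType r A → HasType s B → HasType (prod r s) (.conj A B)
  | conjE {r : Preterm} {A B : Ty} : HasType r (.conj A B) → HasType (proj A r) A

/-! ## Operational semantics -/

/-- The symmetric relation `⇄`: the smallest symmetric contextually closed relation containing
(comm), (asso), (dist) and (curry). -/
inductive Eqv : Preterm → Preterm → Prop
  | comm (r s : Preterm) : Eqv (prod r s) (prod s r)
  | asso (r s t : Preterm) : Eqv (prod (prod r s) t) (prod r (prod s t))
  | dist (X : TyClass) (r s : Preterm) : Eqv (lam X (prod r s)) (prod (lam X r) (lam X s))
  | curry (r s t : Preterm) : Eqv (app (app r s) t) (app r (prod s t))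
  | symm {r s : Preterm} : Eqv r s → Eqv s r
  | lam {X : TyClass} {r s : Preterm} : Eqv r s → Eqv (lam X r) (lam X s)
  | appL {r s t : Preterm} : Eqv r s → Eqv (app r t) (app s t)
  | appR {r s t : Preterm} : Eqv r s → Eqv (app t r) (app t s)
  | prodL {r s t : Preterm} : Eqv r s → Eqv (prod r t) (prod s t)
  | prodR {r s t : Preterm} : Eqv r s → Eqv (prod t r) (prod t s)
  | proj {A : Ty} {r s : Preterm} : Eqv r s → Eqv (proj A r) (proj A s)

/-- Head reductions (β), (π), (ζ). -/
inductive HeadRed : Preterm → Preterm → Prop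
  | beta {A : Ty} {r s : Preterm} :
      HasType s A → HeadRed (app (lam (cls A) r) s) (inst (cls A) s r)
  | proj {A : Ty} {r s : Preterm} : HasType r A → HeadRed (proj A (prod r s)) r
  | zeta (r s t : Preterm) : HeadRed (app (prod r s) t) (prod (app r t) (app s t))

/-- Head expansions (η), (δ). -/
inductive HeadExp : Preterm → Preterm → Prop
  | eta {A B : Ty} {r : Preterm} : HasType r (.arr A B) → IsElimOrVar r →
      HeadExp r (lam (cls A) (app (shift (cls A) r) (var (cls A) 0)))
  | delta {A B : Ty} {r : Preterm} : HasType r (.conj A B) → IsElimOrVar r →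
      HeadExp r (prod (proj A r) (proj B r))

mutual

/-- The reduction relation in which expansion at head position is forbidden. -/
inductive BasicRed : Preterm → Preterm → Prop
  | head {r s : Preterm} : HeadRed r s → BasicRed r s
  | lam {X : TyClass} {r s : Preterm} : Red r s → BasicRed (lam X r) (lam X s)
  | appL {r s t : Preterm} : BasicRed r s → BasicRed (app r t) (app s t)
  | appR {r s t : Preterm} : Red r s → BasicRed (app t r) (app t s)
  | prodL {r s t : Preterm} : Red r s → BasicRed (prod r t) (prod s t)
  | prodR {r s t : Preterm} : Red r s → BasicRed (prod t r) (prod t s)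
  | proj {A : Ty} {r s : Preterm} : BasicRed r s → BasicRed (proj A r) (proj A s)

/-- The reduction relation. -/
inductive Red : Preterm → Preterm → Prop
  | exp {r s : Preterm} : HeadExp r s → Red r s
  | basic {r s : Preterm} : BasicRed r s → Red r s

end

/-- The equivalence of preterms: the reflexive and transitive closure of `⇄`. -/
def EqvStar : Preterm → Preterm → Prop := Relation.ReflTransGen Eqv

/-- Reduction modulo the equivalence of preterms. -/
def RedMod (r s : Preterm) : Prop :=
  ∃ r' s', EqvStar r r' ∧ Red r' s' ∧ EqvStar s' s

/-- `r` is strongly normalising: it is accessible for reduction modulo equivalence, that is (as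
accessibility is the absence of infinite descending sequences), no infinite sequence of reductions
modulo equivalence starts from `r`. -/
def SN (r : Preterm) : Prop := Acc (fun t s => RedMod s t) r

end SystemI

end

noncomputable section

namespace SystemI

/-! ## A domain of monotone functionals -/

/-- The hierarchy of pure types over `ℕ`, interpreted by monotone functionals. -/
def Level : ℕ → PartOrd.{0}
  | 0 => .of PUnit
  | n + 1 => .of (Level n →o ℕ)

namespace Level

/-- A functional of positive level as a monotone function. -/
def toHom {n : ℕ} (f : Level (n + 1)) : Level n →o ℕ := f

/-- A monotone function as a functional of positive level. -/
def ofHom {n : ℕ} (f : Level n →o ℕ) : Level (n + 1) := f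

theorem le_iff {n : ℕ} {f g : Level (n + 1)} : f ≤ g ↔ ∀ x, toHom f x ≤ toHom g x := Iff.rfl

theorem hom_ext {n : ℕ} {f g : Level (n + 1)} (h : ∀ x, toHom f x = toHom g x) : f = g :=
  OrderHom.ext _ _ (funext h)

theorem eq_of_zero (f g : Level 0) : f = g := rfl

/-- The least functional. -/
def zero : ∀ n, Level n
  | 0 => PUnit.unit
  | _ + 1 => ofHom ⟨fun _ => 0, fun _ _ _ => le_rfl⟩

theorem zero_le : ∀ {n : ℕ} (f : Level n), zero n ≤ f
  | 0, _ => le_rfl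
  | _ + 1, _ => fun _ => Nat.zero_le _

/-- The conversions between the levels of the hierarchy. -/
def lift : ∀ m n : ℕ, Level m →o Level n
  | 0, n => ⟨fun _ => zero n, fun _ _ _ => le_rfl⟩
  | _ + 1, 0 => ⟨fun _ => zero 0, fun _ _ _ => le_rfl⟩
  | m + 1, n + 1 =>
    ⟨fun f => ofHom ((toHom f).comp (lift n m)), fun _ _ h x => h (lift n m x)⟩
termination_by m n => m + n

theorem lift_zero_left (n : ℕ) (f : Level 0) : lift 0 n f = zero n := by
  rw [lift]; rfl

theorem toHom_lift (m n : ℕ) (f : Level (m + 1)) (x : Level n) :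
    toHom (lift (m + 1) (n + 1) f) x = toHom f (lift n m x) := by
  rw [lift]; rfl

theorem lift_zero : ∀ m n : ℕ, lift m n (zero m) = zero n
  | 0, _ => lift_zero_left _ _
  | _ + 1, 0 => rfl
  | m + 1, n + 1 => hom_ext fun x => by rw [toHom_lift]; rfl

theorem lift_self : ∀ (n : ℕ) (f : Level n), lift n n f = f
  | 0, _ => rfl
  | n + 1, f => hom_ext fun x => by rw [toHom_lift, lift_self n x]

theorem lift_lift : ∀ (k m n : ℕ), m ≤ k ∨ n ≤ k → ∀ f : Level m,
    lift k n (lift m k f) = lift m n f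
  | _, _, 0, _, _ => rfl
  | k, 0, n, _, f => by rw [lift_zero_left, lift_zero, lift_zero_left]
  | 0, m + 1, n + 1, h, f => by omega
  | k + 1, m + 1, n + 1, h, f => hom_ext fun x => by
      rw [toHom_lift, toHom_lift, toHom_lift, lift_lift k n m (by omega)]

end Level

open Level

/-- A functional of the hierarchy, given by its conversions to all levels. -/
structure Dom where
  /-- The conversion to a level. -/
  val : ∀ k, Level k
  /-- Some level determines the functional. -/
  coherent : ∃ d, ∀ k, val k = lift d k (val d)

namespace Dom

@[ext] theorem ext_val {f g : Dom} (h : ∀ k, f.val k = g.val k) : f = g := by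
  cases f; cases g; congr; exact funext h

instance : PartialOrder Dom where
  le f g := ∀ k, f.val k ≤ g.val k
  le_refl f k := le_rfl
  le_trans f g h hfg hgh k := (hfg k).trans (hgh k)
  le_antisymm f g hfg hgf := ext_val fun k => le_antisymm (hfg k) (hgf k)

/-- A functional of level `d` as an element of the domain. -/
def emb (d : ℕ) (x : Level d) : Dom where
  val k := lift d k x
  coherent := ⟨d, fun k => by rw [lift_self]⟩

theorem emb_mono (d : ℕ) {x y : Level d} (h : x ≤ y) : emb d x ≤ emb d y :=
  fun k => (lift d k).monotone h

/-- A level that determines the functional. -/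
def rank (f : Dom) : ℕ := f.coherent.choose

theorem val_eq (f : Dom) (k : ℕ) : f.val k = lift f.rank k (f.val f.rank) :=
  f.coherent.choose_spec k

theorem lift_val (f : Dom) {j k : ℕ} (h : f.rank ≤ j ∨ k ≤ j) :
    lift j k (f.val j) = f.val k := by
  rw [f.val_eq j, f.val_eq k, lift_lift _ _ _ h]

/-- Application. -/
def ap (f x : Dom) : ℕ := toHom (f.val (f.rank + 1)) (x.val f.rank)

theorem ap_eq (f x : Dom) {j : ℕ} (h : f.rank ≤ j + 1) :
    ap f x = toHom (f.val (j + 1)) (x.val j) := by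
  rcases h' : f.rank with _ | r
  · have e : ∀ k, f.val k = zero k := fun k => by
      rw [f.val_eq k, h']; exact lift_zero_left _ _
    rw [ap, e, e]; rfl
  · have e : ∀ k, r ≤ k →
        toHom (f.val (k + 1)) (x.val k) = toHom (f.val (r + 1)) (x.val r) := fun k hk => by
      have h1 : f.val (k + 1) = lift (r + 1) (k + 1) (f.val (r + 1)) := by
        have := f.val_eq (k + 1); rwa [h'] at this
      rw [h1, toHom_lift, x.lift_val (Or.inr hk)]
    rw [ap, e _ (by omega), e j (by omega)]

theorem ap_emb (f : Dom) (k : ℕ) (y : Level k) : ap f (emb k y) = toHom (f.val (k + 1)) y := by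
  rw [ap_eq f _ (show f.rank ≤ (max f.rank k) + 1 by omega)]
  rcases h' : f.rank with _ | r
  · have e : ∀ k, f.val k = zero k := fun k => by
      rw [f.val_eq k, h']; exact lift_zero_left _ _
    rw [e, e]; rfl
  · have h1 : ∀ j, f.val (j + 1) = lift (r + 1) (j + 1) (f.val (r + 1)) := fun j => by
      have := f.val_eq (j + 1); rwa [h'] at this
    rw [h1, toHom_lift, h1 k, toHom_lift]
    show toHom _ (lift _ _ (lift _ _ y)) = _
    rw [lift_lift _ _ _ (by omega)]

theorem le_iff {f g : Dom} : f ≤ g ↔ ∀ x, ap f x ≤ ap g x := by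
  constructor
  · intro h x
    rw [ap_eq f x (show f.rank ≤ (max f.rank g.rank) + 1 by omega),
      ap_eq g x (show g.rank ≤ (max f.rank g.rank) + 1 by omega)]
    exact Level.le_iff.1 (h _) _
  · rintro h (_ | k)
    · exact le_of_eq (eq_of_zero _ _)
    · intro y
      have := h (emb k y)
      rwa [ap_emb, ap_emb] at this

theorem ext_ap {f g : Dom} (h : ∀ x, ap f x = ap g x) : f = g :=
  le_antisymm (le_iff.2 fun x => (h x).le) (le_iff.2 fun x => (h x).ge)

theorem ap_mono {f g x y : Dom} (hf : f ≤ g) (hx : x ≤ y) : ap f x ≤ ap g y := by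
  refine (le_iff.1 hf x).trans ?_
  exact (toHom (g.val (g.rank + 1))).monotone (hx _)

/-- Truncation to a level. -/
def tr (d : ℕ) (x : Dom) : Dom := emb d (x.val d)

theorem tr_mono (d : ℕ) {x y : Dom} (h : x ≤ y) : tr d x ≤ tr d y := emb_mono d (h d)

theorem ap_tr_succ (d : ℕ) (f x : Dom) : ap (tr (d + 1) f) x = ap f (tr d x) := by
  rw [tr, tr, ap_emb, ap_eq _ _ (show (emb (d + 1) (f.val (d + 1))).rank ≤
    (max d (emb (d + 1) (f.val (d + 1))).rank) + 1 by omega)]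
  show toHom (lift _ _ _) _ = _
  rw [toHom_lift, lift_val _ (by omega)]

theorem tr_tr (d e : ℕ) (x : Dom) : tr d (tr e x) = tr (min d e) x := by
  ext k
  show lift d k (lift e d (x.val e)) = lift _ k (x.val _)
  rcases le_total d e with h | h
  · rw [min_eq_left h, lift_val _ (Or.inr h)]
  · rw [min_eq_right h, lift_lift _ _ _ (Or.inl h)]

theorem tr_rank (f : Dom) : tr f.rank f = f :=
  ext_val fun k => (f.val_eq k).symm

/-- The least element. -/
instance : Zero Dom := ⟨emb 0 (zero 0)⟩

theorem zero_le (f : Dom) : 0 ≤ f := fun k => by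
  show lift 0 k _ ≤ _
  rw [lift_zero_left]; exact Level.zero_le _

@[simp] theorem tr_zero_left (f : Dom) : tr 0 f = 0 := rfl

@[simp] theorem tr_zero (d : ℕ) : tr d 0 = 0 := by
  rw [← tr_zero_left 0, tr_tr]; simp

@[simp] theorem zero_ap (x : Dom) : ap 0 x = 0 := by
  show ap (emb 0 (zero 0)) x = 0
  have e : ∀ k, (emb 0 (zero 0)).val k = zero k := fun k => lift_zero_left _ _
  rw [ap, e]; rfl

theorem tr_le : ∀ (d : ℕ) (f : Dom), tr d f ≤ f
  | 0, f => zero_le f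
  | d + 1, f => le_iff.2 fun x => by
      rw [ap_tr_succ]; exact ap_mono le_rfl (tr_le d x)

theorem tr_le_tr {d e : ℕ} (h : d ≤ e) {x y : Dom} (hx : x ≤ y) : tr d x ≤ tr e y := by
  have : tr d x = tr d (tr e x) := by rw [tr_tr, min_eq_left h]
  rw [this]
  exact (tr_le _ _).trans (tr_mono e hx)

open Classical in
/-- The functional of level `d + 1` given by a monotone function. -/
def lam (d : ℕ) (F : Dom → ℕ) : Dom :=
  if h : Monotone F then
    emb (d + 1) (ofHom ⟨fun y => F (emb d y), fun _ _ hxy => h (emb_mono d hxy)⟩)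
  else 0

theorem ap_lam {F : Dom → ℕ} (h : Monotone F) (d : ℕ) (x : Dom) :
    ap (lam d F) x = F (tr d x) := by
  rw [lam, dif_pos h, ap_eq _ _ (show (emb (d + 1) (ofHom ⟨fun y => F (emb d y),
    fun _ _ hxy => h (emb_mono d hxy)⟩)).rank ≤ (max d (emb (d + 1) (ofHom ⟨fun y => F (emb d y),
    fun _ _ hxy => h (emb_mono d hxy)⟩)).rank) + 1 by omega)]
  show toHom (lift _ _ _) _ = _
  rw [toHom_lift, lift_val _ (by omega)]
  rfl

theorem lam_le_lam {F G : Dom → ℕ} (hF : Monotone F) (hG : Monotone G) {d e : ℕ} (h : d ≤ e)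
    (hFG : ∀ x, F x ≤ G x) : lam d F ≤ lam e G :=
  le_iff.2 fun x => by
    rw [ap_lam hF, ap_lam hG]
    exact (hF (tr_le_tr h le_rfl)).trans (hFG _)

/-- The functionals that are determined by level `d`. -/
def Lv (d : ℕ) (f : Dom) : Prop := tr d f = f

theorem lv_tr (d : ℕ) (f : Dom) : Lv d (tr d f) := by rw [Lv, tr_tr, min_self]

theorem Lv.mono {d e : ℕ} {f : Dom} (hf : Lv d f) (h : d ≤ e) : Lv e f := by
  rw [Lv, ← hf, tr_tr, min_eq_right h]

theorem lv_zero (d : ℕ) : Lv d 0 := tr_zero d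

theorem lv_succ_iff {d : ℕ} {f : Dom} : Lv (d + 1) f ↔ ∀ x, ap f (tr d x) = ap f x :=
  ⟨fun h x => by rw [← ap_tr_succ, h], fun h => ext_ap fun x => by rw [ap_tr_succ, h]⟩

theorem Lv.ap_tr {d e : ℕ} {f : Dom} (hf : Lv d f) (h : d ≤ e + 1) (x : Dom) :
    ap f (tr e x) = ap f x := lv_succ_iff.1 (hf.mono h) x

theorem lv_lam (d : ℕ) (F : Dom → ℕ) : Lv (d + 1) (lam d F) := by
  by_cases h : Monotone F
  · exact lv_succ_iff.2 fun x => by rw [ap_lam h, ap_lam h, tr_tr, min_self]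
  · rw [lam, dif_neg h]; exact lv_zero _

instance : Add Dom := ⟨fun f g => lam (max f.rank g.rank) fun x => ap f x + ap g x⟩

theorem monotone_ap (f : Dom) : Monotone (ap f) := fun _ _ h => ap_mono le_rfl h

@[simp] theorem add_ap (f g x : Dom) : ap (f + g) x = ap f x + ap g x := by
  show ap (lam _ _) x = _
  rw [ap_lam ((monotone_ap f).add (monotone_ap g)),
    Lv.ap_tr (tr_rank f) (by omega), Lv.ap_tr (tr_rank g) (by omega)]

instance : AddCommMonoid Dom where
  add_assoc f g h := ext_ap fun x => by simp [add_assoc]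
  add_comm f g := ext_ap fun x => by simp [add_comm]
  zero_add f := ext_ap fun x => by simp
  add_zero f := ext_ap fun x => by simp
  nsmul := nsmulRec

theorem add_le_add' {f f' g g' : Dom} (hf : f ≤ f') (hg : g ≤ g') : f + g ≤ f' + g' :=
  le_iff.2 fun x => by
    rw [add_ap, add_ap]; exact Nat.add_le_add (ap_mono hf le_rfl) (ap_mono hg le_rfl)

theorem le_add_left' (f g : Dom) : f ≤ g + f := le_iff.2 fun x => by simp
theorem le_add_right' (f g : Dom) : f ≤ f + g := le_iff.2 fun x => by simp

theorem tr_add : ∀ (d : ℕ) (f g : Dom), tr d (f + g) = tr d f + tr d g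
  | 0, f, g => by simp
  | d + 1, f, g => ext_ap fun x => by simp [ap_tr_succ]

theorem Lv.add {d : ℕ} {f g : Dom} (hf : Lv d f) (hg : Lv d g) : Lv d (f + g) := by
  rw [Lv, tr_add, hf, hg]

/-- Strict inequality at every argument. -/
def SLt (f g : Dom) : Prop := ∀ x, ap f x < ap g x

theorem SLt.le {f g : Dom} (h : SLt f g) : f ≤ g := le_iff.2 fun x => (h x).le

theorem SLt.trans_le {f g h : Dom} (hfg : SLt f g) (hgh : g ≤ h) : SLt f h :=
  fun x => (hfg x).trans_le (le_iff.1 hgh x)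

theorem SLt.of_le {f g h : Dom} (hfg : f ≤ g) (hgh : SLt g h) : SLt f h :=
  fun x => (le_iff.1 hfg x).trans_lt (hgh x)

end Dom

namespace Dom

/-! ## Interpretation of the eliminations, and the expansors -/

/-- The interpretation of an application of weight `b`, whose argument `s` has weight `c`. -/
def App (b c : ℕ) (f s : Dom) : Dom := lam (b - 1) fun m => ap f (s + m) + ap s 0 + c

/-- The interpretation of a projection of weight `a`. -/
def Pr (a : ℕ) (f : Dom) : Dom := lam (a - 1) fun m => ap f m + 1

theorem monotone_app_aux (f s : Dom) (c : ℕ) : Monotone fun m => ap f (s + m) + ap s 0 + c :=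
  fun _ _ h => by
    have := ap_mono (le_refl f) (add_le_add' (le_refl s) h)
    simp only; omega

theorem ap_App (b c : ℕ) (f s m : Dom) :
    ap (App b c f s) m = ap f (s + tr (b - 1) m) + ap s 0 + c :=
  ap_lam (monotone_app_aux f s c) _ _

theorem ap_Pr (a : ℕ) (f m : Dom) : ap (Pr a f) m = ap f (tr (a - 1) m) + 1 :=
  ap_lam (fun _ _ h => Nat.succ_le_succ (ap_mono le_rfl h)) _ _

theorem App_mono {b c b' c' : ℕ} {f s f' s' : Dom} (hb : b ≤ b') (hc : c ≤ c') (hf : f ≤ f')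
    (hs : s ≤ s') : App b c f s ≤ App b' c' f' s' :=
  lam_le_lam (monotone_app_aux _ _ _) (monotone_app_aux _ _ _) (by omega) fun m => by
    have h1 := ap_mono hf (add_le_add' hs (le_refl m))
    have h2 := ap_mono hs (le_refl (0 : Dom))
    omega

theorem Pr_mono (a : ℕ) {f f' : Dom} (hf : f ≤ f') : Pr a f ≤ Pr a f' :=
  le_iff.2 fun m => by rw [ap_Pr, ap_Pr]; exact Nat.succ_le_succ (ap_mono hf le_rfl)

theorem lv_App {b : ℕ} (hb : 1 ≤ b) (c : ℕ) (f s : Dom) : Lv b (App b c f s) := by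
  have := lv_lam (b - 1) fun m => ap f (s + m) + ap s 0 + c
  rwa [Nat.sub_add_cancel hb] at this

theorem lv_Pr {a : ℕ} (ha : 1 ≤ a) (f : Dom) : Lv a (Pr a f) := by
  have := lv_lam (a - 1) fun m => ap f m + 1
  rwa [Nat.sub_add_cancel ha] at this

theorem Pr_le_App {a k : ℕ} (ha : 1 ≤ a) (hk : a ≤ k) (f s : Dom) : Pr a f ≤ App k k f s :=
  lam_le_lam (fun _ _ h => Nat.succ_le_succ (ap_mono le_rfl h)) (monotone_app_aux _ _ _)
    (by omega) fun m => by
    have h1 := ap_mono (le_refl f) (le_add_left' m s)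
    omega

/-- The summand that turns the expansor `P` of weight `k` into the one of weight `k + 1`. -/
def expandAux (k : ℕ) (P : Dom → Dom) (f v : Dom) : Dom :=
  P (P (App k k (P f) (P (P v))) + P (App k k (P f) (P (P v))))

/-- The expansor of weight `k`: it bounds the cost of the expansions at head position of a
preterm whose type has weight `k`. -/
def Q : ℕ → Dom → Dom
  | 0 => fun f => f
  | k + 1 => fun f => Q k f + lam k fun v => 1 + 2 * ap (expandAux k (Q k) f v) v

theorem expandAux_mono {k : ℕ} {P : Dom → Dom} (hP : Monotone P) {f g v w : Dom} (hf : f ≤ g)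
    (hv : v ≤ w) : expandAux k P f v ≤ expandAux k P g w := by
  have h := hP (App_mono (le_refl k) (le_refl k) (hP hf) (hP (hP hv)))
  exact hP (add_le_add' h h)

theorem monotone_expand_aux {k : ℕ} {P : Dom → Dom} (hP : Monotone P) (f : Dom) :
    Monotone fun v => 1 + 2 * ap (expandAux k P f v) v := fun v w h => by
  have := ap_mono (expandAux_mono (k := k) hP (le_refl f) h) h
  simp only; omega

theorem Q_mono : ∀ k : ℕ, Monotone (Q k)
  | 0 => fun _ _ h => h
  | k + 1 => fun f g h => by
    refine add_le_add' (Q_mono k h) (lam_le_lam (monotone_expand_aux (Q_mono k) f)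
      (monotone_expand_aux (Q_mono k) g) le_rfl fun v => ?_)
    have := ap_mono (expandAux_mono (k := k) (Q_mono k) h (le_refl v)) (le_refl v)
    omega

theorem Q_le_succ (k : ℕ) (f : Dom) : Q k f ≤ Q (k + 1) f := le_add_right' _ _

theorem Q_le_Q {j k : ℕ} (h : j ≤ k) {f g : Dom} (hf : f ≤ g) : Q j f ≤ Q k g := by
  refine (Q_mono j hf).trans ?_
  induction h with
  | refl => exact le_rfl
  | step _ ih => exact ih.trans (Q_le_succ _ _)

theorem le_Q (k : ℕ) (f : Dom) : f ≤ Q k f := Q_le_Q (Nat.zero_le k) le_rfl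

theorem SLt.Q {f g : Dom} (h : SLt f g) : ∀ k : ℕ, SLt (Dom.Q k f) (Dom.Q k g)
  | 0 => h
  | k + 1 => fun v => by
    have h1 := SLt.Q h k v
    have h2 : ap (lam k fun v => 1 + 2 * ap (expandAux k (Dom.Q k) f v) v) v ≤
        ap (lam k fun v => 1 + 2 * ap (expandAux k (Dom.Q k) g v) v) v := by
      rw [ap_lam (monotone_expand_aux (Q_mono k) f), ap_lam (monotone_expand_aux (Q_mono k) g)]
      have := ap_mono (expandAux_mono (k := k) (Q_mono k) h.le (le_refl (tr k v)))
        (le_refl (tr k v))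
      omega
    show ap (_ + _) v < ap (_ + _) v
    rw [add_ap, add_ap]
    omega

theorem lv_Q {n : ℕ} {f : Dom} (hf : Lv n f) : ∀ {k : ℕ}, k ≤ n → Lv n (Q k f)
  | 0, _ => hf
  | _ + 1, h => (lv_Q hf (by omega)).add ((lv_lam _ _).mono h)

theorem expandAux_lt (k : ℕ) (f v : Dom) :
    2 * ap (expandAux k (Q k) f (tr k v)) (tr k v) < ap (Q (k + 1) f) v := by
  show _ < ap (_ + _) v
  rw [add_ap, ap_lam (monotone_expand_aux (Q_mono k) f)]
  omega

/-- A functional below the inner application is bounded by the expansor, after expansions at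
two levels. -/
theorem Q_Q_add_le_expandAux {k i : ℕ} (hi : i ≤ k) {f v G H : Dom}
    (hG : G ≤ App k k (Q k f) (Q k (Q k v))) (hH : H ≤ App k k (Q k f) (Q k (Q k v)))
    {a b : ℕ} (ha : a ≤ k) (hb : b ≤ k) :
    Q i (Q a G + Q b H) ≤ expandAux k (Q k) f v :=
  Q_le_Q hi (add_le_add' (Q_le_Q ha hG) (Q_le_Q hb hH))

theorem Q_le_expandAux {k i : ℕ} (hi : i ≤ k) {f v G : Dom}
    (hG : G ≤ App k k (Q k f) (Q k (Q k v))) : Q i G ≤ expandAux k (Q k) f v :=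
  Q_le_Q hi ((hG.trans (le_Q k _)).trans (le_add_right' _ _))

theorem lt_two_pow_mul {a b : ℕ} (hb : 1 ≤ b) : a < 2 ^ a * b :=
  a.lt_two_pow_self.trans_le (Nat.le_mul_of_pos_right _ hb)

theorem lt_two_pow_mul' {a b : ℕ} (ha : 1 ≤ a) (hb : 1 ≤ b) : b < 2 ^ a * b := by
  have : 2 ≤ 2 ^ a := by
    calc 2 = 2 ^ 1 := rfl
      _ ≤ 2 ^ a := Nat.pow_le_pow_right (by norm_num) ha
  nlinarith

/-- Expansors pay for `η`. -/
theorem eta_lt_Q {a b n : ℕ} (ha : 1 ≤ a) (hb : 1 ≤ b) (hn : n = 2 ^ a * b) (f v : Dom) :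
    ap (Q b (App b a f (Q a (Q a (tr a (tr (n - 1) v)))))) (tr (n - 1) v) < ap (Q n f) v := by
  obtain ⟨k, rfl⟩ : ∃ k, n = k + 1 := ⟨n - 1, by have := lt_two_pow_mul (a := a) hb; omega⟩
  have hak : a ≤ k := by have := lt_two_pow_mul (a := a) hb; omega
  have hbk : b ≤ k := by have := lt_two_pow_mul' ha hb; omega
  have h1 : ap (Q b (App b a f (Q a (Q a (tr a (tr k v)))))) (tr k v) ≤
      ap (expandAux k (Q k) f (tr k v)) (tr k v) :=
    ap_mono (Q_le_expandAux hbk (App_mono hbk hak (le_Q k f)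
      (Q_le_Q hak (Q_le_Q hak (tr_le _ _))))) le_rfl
  have h2 := expandAux_lt k f v
  simp only [Nat.add_sub_cancel]
  omega

/-- Expansors pay for `δ`. -/
theorem delta_slt_Q {a b : ℕ} (ha : 1 ≤ a) (hb : 1 ≤ b) (f : Dom) :
    SLt (Q a (Pr a f) + Q b (Pr b f)) (Q (a + b) f) := fun v => by
  obtain ⟨k, hk⟩ : ∃ k, a + b = k + 1 := ⟨a + b - 1, by omega⟩
  rw [hk]
  have h : ∀ c, 1 ≤ c → c ≤ k → ap (Q c (Pr c f)) v ≤
      ap (expandAux k (Q k) f (tr k v)) (tr k v) := fun c hc hck => by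
    rw [← (lv_Q (lv_Pr hc f) le_rfl).ap_tr (show c ≤ k + 1 by omega)]
    exact ap_mono (Q_le_expandAux hck ((Pr_le_App hc hck f _).trans
      (App_mono le_rfl le_rfl (le_Q k f) le_rfl))) le_rfl
  have h1 := h a ha (by omega)
  have h2 := h b hb (by omega)
  have h3 := expandAux_lt k f v
  rw [add_ap]
  omega

/-- Expansors pay for `ζ` in non-head position. -/
theorem zeta_slt_Q {a b c : ℕ} (ha : 1 ≤ a) (hb : 1 ≤ b) {f g h t : Dom} (hf : f ≤ h)
    (hg : g ≤ h) :
    SLt (Q a (App a c f t) + Q b (App b c g t)) (Q (a + b) (App (a + b) c h t)) := by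
  have key : ∀ d, d ≤ a + b → ∀ f, f ≤ h →
      App d c f t ≤ Pr d (App (a + b) c h t) := fun d hd f hf => le_iff.2 fun m => by
    rw [ap_Pr, ap_App, ap_App, tr_tr, min_eq_right (by omega)]
    have := ap_mono hf (le_refl (t + tr (d - 1) m))
    omega
  exact (delta_slt_Q ha hb _).of_le (add_le_add' (Q_mono a (key a (by omega) f hf))
    (Q_mono b (key b (by omega) g hg)))

/-- Expansors pay for `ζ` in head position. -/
theorem zeta_slt_App {a b c : ℕ} (ha : 1 ≤ a) (hb : 1 ≤ b) (hc : 1 ≤ c) {f g R t : Dom}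
    (ht : Lv c t) (hf : f ≤ Q (2 ^ c * a) R) (hg : g ≤ Q (2 ^ c * b) R) :
    SLt (Q (a + b) (Q a (App a c f t) + Q b (App b c g t)))
      (App (a + b) c (Q (2 ^ c * a + 2 ^ c * b) R) t) := fun m => by
  obtain ⟨k, hk⟩ : ∃ k, 2 ^ c * a + 2 ^ c * b = k + 1 :=
    ⟨2 ^ c * a + 2 ^ c * b - 1, by have := lt_two_pow_mul (a := c) ha; omega⟩
  have hca := lt_two_pow_mul (a := c) ha
  have hcb := lt_two_pow_mul (a := c) hb
  have h1 := lt_two_pow_mul' hc ha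
  have h2 := lt_two_pow_mul' hc hb
  have hlv : Lv (a + b) (Q (a + b) (Q a (App a c f t) + Q b (App b c g t))) := by
    refine lv_Q (Lv.add ?_ ?_) le_rfl
    · exact (lv_Q (lv_App ha _ _ _) le_rfl).mono (by omega)
    · exact (lv_Q (lv_App hb _ _ _) le_rfl).mono (by omega)
  rw [← hlv.ap_tr (show a + b ≤ (a + b - 1) + 1 by omega), ap_App, hk]
  set m' := tr (a + b - 1) m
  have hm' : Lv k (t + m') := (ht.mono (by omega)).add ((lv_tr _ _).mono (by omega))
  have h3 := expandAux_lt k R (t + m')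
  rw [hm'] at h3
  have ht' : t ≤ Q k (Q k (t + m')) :=
    ((le_add_right' t m').trans (le_Q k _)).trans (le_Q k _)
  have h4 : ap (Q (a + b) (Q a (App a c f t) + Q b (App b c g t))) m' ≤
      ap (expandAux k (Q k) R (t + m')) (t + m') :=
    ap_mono (Q_Q_add_le_expandAux (by omega)
      (App_mono (by omega) (by omega) (hf.trans (Q_le_Q (by omega) le_rfl)) ht')
      (App_mono (by omega) (by omega) (hg.trans (Q_le_Q (by omega) le_rfl)) ht')
      (by omega) (by omega)) (le_add_left' _ _)
  omega

/-- Expansors pay for `β`. -/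
theorem beta_slt_App {a b n : ℕ} (ha : 1 ≤ a) (hb : 1 ≤ b) (hn : n = 2 ^ a * b) {F G t : Dom}
    (ht : Lv a t) (hG : Lv b G) (h : ∀ x y, t ≤ x → y ≤ x → ap G y ≤ ap F x) :
    SLt (Q b G) (App b a (Q n F) t) := fun m => by
  obtain ⟨k, rfl⟩ : ∃ k, n = k + 1 := ⟨n - 1, by have := lt_two_pow_mul (a := a) hb; omega⟩
  have hak : a ≤ k := by have := lt_two_pow_mul (a := a) hb; omega
  have hbk : b ≤ k := by have := lt_two_pow_mul' ha hb; omega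
  rw [← (lv_Q hG le_rfl).ap_tr (show b ≤ (b - 1) + 1 by omega), ap_App]
  set m' := tr (b - 1) m
  have hm' : Lv k (t + m') := (ht.mono (by omega)).add ((lv_tr _ _).mono (by omega))
  have h3 := expandAux_lt k F (t + m')
  rw [hm'] at h3
  have h4 : ap (Q b G) m' ≤ ap (expandAux k (Q k) F (t + m')) (t + m') := by
    refine ap_mono (Q_le_expandAux hbk ?_) (le_add_left' _ _)
    have ht' : t ≤ Q k (Q k (t + m')) :=
      ((le_add_right' t m').trans (le_Q k _)).trans (le_Q k _)
    refine le_trans ?_ (App_mono hbk (Nat.zero_le k) (le_Q k F) ht')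
    refine le_iff.2 fun y => ?_
    rw [ap_App, ← hG.ap_tr (show b ≤ (b - 1) + 1 by omega)]
    have := h (t + tr (b - 1) y) (tr (b - 1) y) (le_add_right' _ _) (le_add_left' _ _)
    omega
  omega

/-- Projections are strictly above what they project from. -/
theorem slt_Pr {a n : ℕ} (ha : 1 ≤ a) (h : a ≤ n) {f g : Dom} (hf : Lv a f) (hfg : f ≤ g) :
    SLt (Q a f) (Pr a (Q n g)) := fun m => by
  rw [ap_Pr, ← (lv_Q hf le_rfl).ap_tr (show a ≤ (a - 1) + 1 by omega)]
  exact Nat.lt_succ_of_le (ap_mono (Q_le_Q h hfg) le_rfl)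

end Dom

/-! ## Weights of types and inference of types -/

/-- The weight of a type, given by the weights of the domains of its prime factors. -/
def wt (M : Multiset ℕ) : ℕ := (M.map fun p => 2 ^ p).sum

theorem wt_add (M N : Multiset ℕ) : wt (M + N) = wt M + wt N := by simp [wt]

theorem wt_map_add (M : Multiset ℕ) (a : ℕ) : wt (M.map (· + a)) = 2 ^ a * wt M := by
  simp only [wt, Multiset.map_map, Function.comp_def, pow_add, Multiset.sum_map_mul_right]
  ring

theorem wt_pos {M : Multiset ℕ} (h : M ≠ 0) : 1 ≤ wt M := by
  obtain ⟨p, hp⟩ := Multiset.exists_mem_of_ne_zero h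
  obtain ⟨N, rfl⟩ := Multiset.exists_cons_of_mem hp
  have : 1 ≤ 2 ^ p := Nat.one_le_two_pow
  simp only [wt, Multiset.map_cons, Multiset.sum_cons]
  omega

/-- The weights of the domains of the prime factors of a type. -/
def sem : Ty → Multiset ℕ
  | .atom => {0}
  | .arr A B => (sem B).map (· + wt (sem A))
  | .conj A B => sem A + sem B

theorem sem_congr {A B : Ty} (h : TyEquiv A B) : sem A = sem B := by
  induction h with
  | comm A B => exact add_comm _ _
  | asso A B C => exact (add_assoc _ _ _).symm
  | dist A B C => exact Multiset.map_add _ _ _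
  | curry A B C =>
    simp only [sem, Multiset.map_map, Function.comp_def, wt_add]
    congr 1; funext p; omega
  | refl => rfl
  | symm _ ih => exact ih.symm
  | trans _ _ ih1 ih2 => exact ih1.trans ih2
  | arr _ _ ih1 ih2 => simp only [sem, ih1, ih2]
  | conj _ _ ih1 ih2 => simp only [sem, ih1, ih2]

theorem sem_ne_zero : ∀ A : Ty, sem A ≠ 0
  | .atom => by simp [sem]
  | .arr A B => by simpa [sem] using sem_ne_zero B
  | .conj A B => by simp [sem, sem_ne_zero A]

/-- `sem` on classes of types. -/
def semc (X : TyClass) : Multiset ℕ := Quotient.lift sem (fun _ _ h => sem_congr h) X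

@[simp] theorem semc_cls (A : Ty) : semc (cls A) = sem A := rfl

theorem semc_ne_zero (X : TyClass) : semc X ≠ 0 := by
  induction X using Quotient.inductionOn with
  | _ A => exact sem_ne_zero A

namespace Preterm

/-- The inferred type of a preterm. -/
def typ : Preterm → Multiset ℕ
  | var X _ => semc X
  | lam X r => (typ r).map (· + wt (semc X))
  | app r s => (typ r).map (· - wt (typ s))
  | prod r s => typ r + typ s
  | proj A _ => sem A

/-- The weight of the inferred type of a preterm. -/
def W (r : Preterm) : ℕ := wt (typ r)

/-- The preterms in which the inferred types fit together. -/
def Ok : Preterm → Prop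
  | var _ _ => True
  | lam _ r => Ok r
  | app r s => Ok r ∧ Ok s ∧ ∀ p ∈ typ r, W s ≤ p
  | prod r s => Ok r ∧ Ok s
  | proj A r => Ok r ∧ sem A ≤ typ r

theorem typ_ne_zero : ∀ r : Preterm, typ r ≠ 0
  | var X _ => semc_ne_zero X
  | lam X r => by simpa [typ] using typ_ne_zero r
  | app r s => by simpa [typ] using typ_ne_zero r
  | prod r s => by simp [typ, typ_ne_zero r]
  | proj A _ => sem_ne_zero A

theorem W_pos (r : Preterm) : 1 ≤ W r := wt_pos (typ_ne_zero r)

theorem W_prod (r s : Preterm) : W (prod r s) = W r + W s := wt_add _ _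

theorem W_lam (X : TyClass) (r : Preterm) : W (lam X r) = 2 ^ wt (semc X) * W r :=
  wt_map_add _ _

theorem map_sub_map_add {M : Multiset ℕ} {a : ℕ} (h : ∀ p ∈ M, a ≤ p) :
    (M.map (· - a)).map (· + a) = M := by
  rw [Multiset.map_map]
  exact (Multiset.map_congr rfl fun p hp => Nat.sub_add_cancel (h p hp)).trans (Multiset.map_id M)

theorem map_add_map_sub (M : Multiset ℕ) (a : ℕ) : (M.map (· + a)).map (· - a) = M := by
  simp [Multiset.map_map]

theorem W_app {r s : Preterm} (h : ∀ p ∈ typ r, W s ≤ p) : W r = 2 ^ W s * W (app r s) := by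
  rw [W, ← map_sub_map_add h, wt_map_add]; rfl

end Preterm

open Preterm

theorem HasType.ok_and_typ {r : Preterm} {A : Ty} (h : HasType r A) :
    Ok r ∧ typ r = sem A := by
  induction h with
  | ax A n => exact ⟨trivial, rfl⟩
  | conv e _ ih => exact ⟨ih.1, ih.2.trans (sem_congr e)⟩
  | arrI _ ih => exact ⟨ih.1, by simp [typ, ih.2, sem]⟩
  | arrE _ _ ih1 ih2 =>
    refine ⟨⟨ih1.1, ih2.1, ?_⟩, ?_⟩
    · intro p hp
      simp only [ih1.2, sem, Multiset.mem_map] at hp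
      obtain ⟨q, _, rfl⟩ := hp
      simp [W, ih2.2]
    · simp only [typ, ih1.2, ih2.2, sem, map_add_map_sub]
  | conjI _ _ ih1 ih2 => exact ⟨⟨ih1.1, ih2.1⟩, by simp [typ, ih1.2, ih2.2, sem]⟩
  | conjE _ ih => exact ⟨⟨ih.1, by rw [ih.2]; exact Multiset.le_add_right _ _⟩, rfl⟩

namespace Preterm

@[simp] theorem typ_rename (r : Preterm) : ∀ ρ : TyClass → ℕ → ℕ, typ (rename ρ r) = typ r := by
  induction r with
  | var => intro ρ; rfl
  | lam X r ih => intro ρ; simp [rename, typ, ih]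
  | app r s ih1 ih2 => intro ρ; simp [rename, typ, ih1, ih2]
  | prod r s ih1 ih2 => intro ρ; simp [rename, typ, ih1, ih2]
  | proj A r ih => intro ρ; simp [rename, typ]

@[simp] theorem W_rename (ρ : TyClass → ℕ → ℕ) (r : Preterm) : W (rename ρ r) = W r := by
  rw [W, typ_rename, W]

@[simp] theorem ok_rename (r : Preterm) : ∀ ρ : TyClass → ℕ → ℕ, Ok (rename ρ r) ↔ Ok r := by
  induction r with
  | var => intro ρ; rfl
  | lam X r ih => intro ρ; simp [rename, Ok, ih]
  | app r s ih1 ih2 => intro ρ; simp [rename, Ok, ih1, ih2]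
  | prod r s ih1 ih2 => intro ρ; simp [rename, Ok, ih1, ih2]
  | proj A r ih => intro ρ; simp [rename, Ok, ih]

@[simp] theorem typ_shift (X : TyClass) (r : Preterm) : typ (shift X r) = typ r := typ_rename _ _

@[simp] theorem ok_shift (X : TyClass) (r : Preterm) : Ok (shift X r) ↔ Ok r := ok_rename _ _

/-- The substitutions by well-typed preterms of the right types. -/
def OkSubst (σ : TyClass → ℕ → Preterm) : Prop := ∀ X n, Ok (σ X n) ∧ typ (σ X n) = semc X

theorem OkSubst.up {σ : TyClass → ℕ → Preterm} (h : OkSubst σ) (X : TyClass) :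
    OkSubst (Preterm.up X σ) := by
  intro Y n
  unfold Preterm.up
  split
  · cases n with
    | zero => exact ⟨trivial, rfl⟩
    | succ k => simpa using h Y k
  · simpa using h Y n

theorem OkSubst.ok_and_typ (r : Preterm) : ∀ {σ : TyClass → ℕ → Preterm}, OkSubst σ → Ok r →
    Ok (subst σ r) ∧ typ (subst σ r) = typ r := by
  induction r with
  | var X n => intro σ h _; exact h X n
  | lam X r ih =>
    intro σ h hr
    have := ih (h.up X) hr
    exact ⟨this.1, by simp [subst, typ, this.2]⟩
  | app r s ih1 ih2 =>
    rintro σ h ⟨hr, hs, hp⟩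
    have h1 := ih1 h hr
    have h2 := ih2 h hs
    exact ⟨⟨h1.1, h2.1, by rw [h1.2, W, h2.2]; exact hp⟩, by simp [subst, typ, h1.2, h2.2]⟩
  | prod r s ih1 ih2 =>
    rintro σ h ⟨hr, hs⟩
    have h1 := ih1 h hr
    have h2 := ih2 h hs
    exact ⟨⟨h1.1, h2.1⟩, by simp [subst, typ, h1.2, h2.2]⟩
  | proj A r ih =>
    rintro σ h ⟨hr, hA⟩
    have h1 := ih h hr
    exact ⟨⟨h1.1, by rw [h1.2]; exact hA⟩, rfl⟩

/-- The substitution of one preterm for the variable `0` of class `X`. -/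
def single (X : TyClass) (s : Preterm) : TyClass → ℕ → Preterm := fun Y n =>
  open Classical in
  if Y = X then
    match n with
    | 0 => s
    | k + 1 => var Y k
  else var Y n

theorem inst_eq (X : TyClass) (s r : Preterm) : inst X s r = subst (single X s) r := rfl

theorem okSubst_single {X : TyClass} {s : Preterm} (hs : Ok s) (hX : typ s = semc X) :
    OkSubst (single X s) := by
  intro Y n
  unfold single
  split
  · rename_i h
    subst h
    cases n with
    | zero => exact ⟨hs, hX⟩
    | succ k => exact ⟨trivial, rfl⟩
  · exact ⟨trivial, rfl⟩

end Preterm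

/-! ## Subject reduction for inferred types -/

theorem Eqv.ok_and_typ {r s : Preterm} (h : Eqv r s) : (Ok r ↔ Ok s) ∧ typ r = typ s := by
  induction h with
  | comm r s => exact ⟨and_comm, add_comm _ _⟩
  | asso r s t => exact ⟨and_assoc, add_assoc _ _ _⟩
  | dist X r s => exact ⟨Iff.rfl, Multiset.map_add _ _ _⟩
  | curry r s t =>
    constructor
    · simp only [Ok, W_prod, typ, Multiset.mem_map, forall_exists_index, and_imp,
        forall_apply_eq_imp_iff₂]
      constructor
      · rintro ⟨⟨hr, hs, h1⟩, ht, h2⟩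
        exact ⟨hr, ⟨hs, ht⟩, fun p hp => by
          have := h1 p hp; have := h2 p hp; simp only [W] at *; omega⟩
      · rintro ⟨hr, ⟨hs, ht⟩, h⟩
        exact ⟨⟨hr, hs, fun p hp => by have := h p hp; omega⟩, ht, fun p hp => by
          have := h p hp; simp only [W] at *; omega⟩
    · simp only [typ, Multiset.map_map, Function.comp_def, wt_add]
      congr 1; funext p; omega
  | symm _ ih => exact ⟨ih.1.symm, ih.2.symm⟩
  | lam _ ih => exact ⟨ih.1, by simp only [typ, ih.2]⟩
  | appL _ ih => exact ⟨by simp only [Ok, ih.1, ih.2], by simp only [typ, ih.2]⟩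
  | appR _ ih => exact ⟨by simp only [Ok, W, ih.1, ih.2], by simp only [typ, ih.2]⟩
  | prodL _ ih => exact ⟨by simp only [Ok, ih.1], by simp only [typ, ih.2]⟩
  | prodR _ ih => exact ⟨by simp only [Ok, ih.1], by simp only [typ, ih.2]⟩
  | proj _ ih => exact ⟨by simp only [Ok, ih.1, ih.2], rfl⟩

theorem HeadRed.ok_and_typ {r s : Preterm} (h : HeadRed r s) (hr : Ok r) :
    Ok s ∧ typ s = typ r := by
  cases h with
  | @beta A r s hs =>
    obtain ⟨hr, _, _⟩ := hr
    have hs := hs.ok_and_typ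
    have := OkSubst.ok_and_typ r (okSubst_single (X := cls A) hs.1 hs.2) hr
    refine ⟨this.1, this.2.trans ?_⟩
    simp only [typ, hs.2, semc_cls, map_add_map_sub]
  | proj ht => exact ⟨hr.1.1, ht.ok_and_typ.2⟩
  | zeta r s t =>
    obtain ⟨⟨hr, hs⟩, ht, hp⟩ := hr
    simp only [typ, Multiset.mem_add] at hp
    exact ⟨⟨⟨hr, ht, fun p h => hp p (.inl h)⟩, hs, ht, fun p h => hp p (.inr h)⟩,
      (Multiset.map_add _ _ _).symm⟩

theorem HeadExp.ok_and_typ {r s : Preterm} (h : HeadExp r s) : Ok s ∧ typ s = typ r := by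
  cases h with
  | eta ht _ =>
    obtain ⟨hr, h⟩ := ht.ok_and_typ
    refine ⟨⟨(ok_shift _ _).2 hr, trivial, ?_⟩, ?_⟩
    · intro p hp
      simp only [typ_shift, h, sem, Multiset.mem_map] at hp
      obtain ⟨q, _, rfl⟩ := hp
      simp [W, typ]
    · simp only [typ, typ_shift, h, sem, semc_cls, map_add_map_sub]
  | delta ht _ =>
    obtain ⟨hr, h⟩ := ht.ok_and_typ
    exact ⟨⟨⟨hr, by rw [h]; exact Multiset.le_add_right _ _⟩,
      ⟨hr, by rw [h]; exact Multiset.le_add_left _ _⟩⟩, h.symm⟩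

mutual

theorem BasicRed.ok_and_typ {r s : Preterm} (h : BasicRed r s) (hr : Ok r) :
    Ok s ∧ typ s = typ r := by
  cases h with
  | head h => exact h.ok_and_typ hr
  | lam h => have := h.ok_and_typ hr; exact ⟨this.1, by simp only [typ, this.2]⟩
  | appL h =>
    have := h.ok_and_typ hr.1
    exact ⟨⟨this.1, hr.2.1, by rw [this.2]; exact hr.2.2⟩, by simp only [typ, this.2]⟩
  | appR h =>
    have := h.ok_and_typ hr.2.1
    exact ⟨⟨hr.1, this.1, by rw [W, this.2]; exact hr.2.2⟩, by simp only [typ, this.2]⟩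
  | prodL h =>
    have := h.ok_and_typ hr.1
    exact ⟨⟨this.1, hr.2⟩, by simp only [typ, this.2]⟩
  | prodR h =>
    have := h.ok_and_typ hr.2
    exact ⟨⟨hr.1, this.1⟩, by simp only [typ, this.2]⟩
  | proj h =>
    have := h.ok_and_typ hr.1
    exact ⟨⟨this.1, by rw [this.2]; exact hr.2⟩, rfl⟩

theorem Red.ok_and_typ {r s : Preterm} (h : Red r s) (hr : Ok r) : Ok s ∧ typ s = typ r := by
  cases h with
  | exp h => exact h.ok_and_typ
  | basic h => exact h.ok_and_typ hr

end

open Preterm Dom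

/-! ## The interpretation of preterms -/

/-- Valuations of the variables. -/
abbrev Env : Type := TyClass → ℕ → Dom

/-- The valuation under a binder of class `X`. -/
def push (X : TyClass) (d : Dom) (ρ : Env) : Env := fun Y n =>
  open Classical in
  if Y = X then
    match n with
    | 0 => d
    | k + 1 => ρ Y k
  else ρ Y n

/-- The value, in a position where expansion is allowed, of a preterm with a given value. -/
def atFull : Preterm → Dom → Dom
  | .var X n => Q (W (.var X n))
  | .lam _ _ => id
  | .app r s => Q (W (.app r s))
  | .prod _ _ => id
  | .proj A r => Q (W (.proj A r))

/-- The value, in a position where expansion is forbidden, of a preterm with a given value. -/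
def atHead : Preterm → Dom → Dom
  | .var _ _ => id
  | .lam X r => Q (W (.lam X r))
  | .app _ _ => id
  | .prod r s => Q (W (.prod r s))
  | .proj _ _ => id

/-- The value of a preterm, without the cost of the expansions at its head. -/
def raw : Preterm → Env → Dom
  | .var X n, ρ => ρ X n
  | .lam X r, ρ => Dom.lam (W (.lam X r) - 1) fun v =>
      ap (atFull r (raw r (push X (Q (wt (semc X)) (tr (wt (semc X)) v)) ρ))) v
  | .app r s, ρ => App (W (.app r s)) (W s) (atHead r (raw r ρ)) (atFull s (raw s ρ))
  | .prod r s, ρ => atFull r (raw r ρ) + atFull s (raw s ρ)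
  | .proj A r, ρ => Pr (wt (sem A)) (atHead r (raw r ρ))

/-- The value of a preterm in a position where expansion is allowed. -/
def full (r : Preterm) (ρ : Env) : Dom := atFull r (raw r ρ)

/-- The value of a preterm in a position where expansion is forbidden. -/
def hd (r : Preterm) (ρ : Env) : Dom := atHead r (raw r ρ)

theorem atFull_mono (r : Preterm) : Monotone (atFull r) := by
  cases r <;> first | exact Q_mono _ | exact monotone_id

theorem atHead_mono (r : Preterm) : Monotone (atHead r) := by
  cases r <;> first | exact Q_mono _ | exact monotone_id

theorem le_atFull (r : Preterm) (x : Dom) : x ≤ atFull r x := by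
  cases r <;> first | exact le_Q _ _ | exact le_rfl

theorem atFull_le_Q (r : Preterm) (x : Dom) : atFull r x ≤ Q (W r) x := by
  cases r <;> first | exact le_Q _ _ | exact le_rfl

theorem atHead_le_Q (r : Preterm) (x : Dom) : atHead r x ≤ Q (W r) x := by
  cases r <;> first | exact le_Q _ _ | exact le_rfl

theorem Dom.SLt.atFull (r : Preterm) {x y : Dom} (h : SLt x y) :
    SLt (SystemI.atFull r x) (SystemI.atFull r y) := by
  cases r <;> first | exact h.Q _ | exact h

theorem Dom.SLt.atHead (r : Preterm) {x y : Dom} (h : SLt x y) :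
    SLt (SystemI.atHead r x) (SystemI.atHead r y) := by
  cases r <;> first | exact h.Q _ | exact h

theorem lv_atFull {r : Preterm} {x : Dom} (h : Lv (W r) x) : Lv (W r) (atFull r x) := by
  cases r <;> first | exact lv_Q h le_rfl | exact h

theorem push_mono {X : TyClass} {d e : Dom} {ρ τ : Env} (hd : d ≤ e) (h : ∀ Y n, ρ Y n ≤ τ Y n)
    (Y : TyClass) (n : ℕ) : push X d ρ Y n ≤ push X e τ Y n := by
  unfold push
  split
  · cases n with
    | zero => exact hd
    | succ k => exact h Y k
  · exact h Y n

theorem ap_raw_lam_aux {X : TyClass} {r : Preterm}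
    (ih : ∀ {ρ τ : Env}, (∀ Y n, ρ Y n ≤ τ Y n) → raw r ρ ≤ raw r τ) {ρ τ : Env}
    (h : ∀ Y n, ρ Y n ≤ τ Y n) {v w : Dom} (hv : v ≤ w) :
    ap (full r (push X (Q (wt (semc X)) (tr (wt (semc X)) v)) ρ)) v ≤
      ap (full r (push X (Q (wt (semc X)) (tr (wt (semc X)) w)) τ)) w :=
  ap_mono (atFull_mono r (ih (push_mono (Q_mono _ (tr_mono _ hv)) h))) hv

theorem raw_mono (r : Preterm) : ∀ {ρ τ : Env}, (∀ Y n, ρ Y n ≤ τ Y n) → raw r ρ ≤ raw r τ := by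
  induction r with
  | var X n => intro ρ τ h; exact h X n
  | lam X r ih =>
    intro ρ τ h
    exact lam_le_lam (fun v w hv => ap_raw_lam_aux ih (fun _ _ => le_rfl) hv)
      (fun v w hv => ap_raw_lam_aux ih (fun _ _ => le_rfl) hv) le_rfl
      fun v => ap_raw_lam_aux ih h le_rfl
  | app r s ih1 ih2 =>
    intro ρ τ h
    exact App_mono le_rfl le_rfl (atHead_mono r (ih1 h)) (atFull_mono s (ih2 h))
  | prod r s ih1 ih2 =>
    intro ρ τ h
    exact add_le_add' (atFull_mono r (ih1 h)) (atFull_mono s (ih2 h))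
  | proj A r ih =>
    intro ρ τ h
    exact Pr_mono _ (atHead_mono r (ih h))

theorem full_mono (r : Preterm) {ρ τ : Env} (h : ∀ Y n, ρ Y n ≤ τ Y n) :
    full r ρ ≤ full r τ := atFull_mono r (raw_mono r h)

/-- The valuations that respect the levels. -/
def LvEnv (ρ : Env) : Prop := ∀ X n, Lv (wt (semc X)) (ρ X n)

theorem LvEnv.push {ρ : Env} (h : LvEnv ρ) {X : TyClass} {d : Dom} (hd : Lv (wt (semc X)) d) :
    LvEnv (push X d ρ) := by
  intro Y n
  unfold SystemI.push
  split
  · rename_i e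
    subst e
    cases n with
    | zero => exact hd
    | succ k => exact h Y k
  · exact h Y n

theorem LvEnv.push_Q {ρ : Env} (h : LvEnv ρ) (X : TyClass) (v : Dom) :
    LvEnv (SystemI.push X (Q (wt (semc X)) (tr (wt (semc X)) v)) ρ) :=
  h.push (lv_Q (lv_tr _ _) le_rfl)

theorem lv_raw (r : Preterm) : ∀ {ρ : Env}, LvEnv ρ → Lv (W r) (raw r ρ) := by
  induction r with
  | var X n => intro ρ h; exact h X n
  | lam X r ih =>
    intro ρ h
    have := lv_lam (W (.lam X r) - 1) fun v =>
      ap (full r (push X (Q (wt (semc X)) (tr (wt (semc X)) v)) ρ)) v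
    rwa [Nat.sub_add_cancel (W_pos _)] at this
  | app r s ih1 ih2 => intro ρ h; exact lv_App (W_pos _) _ _ _
  | prod r s ih1 ih2 =>
    intro ρ h
    rw [W_prod]
    exact ((lv_atFull (ih1 h)).mono (by omega)).add ((lv_atFull (ih2 h)).mono (by omega))
  | proj A r ih => intro ρ h; exact lv_Pr (wt_pos (sem_ne_zero A)) _

theorem lv_full (r : Preterm) {ρ : Env} (h : LvEnv ρ) : Lv (W r) (full r ρ) :=
  lv_atFull (lv_raw r h)

theorem monotone_lam_body (X : TyClass) (r : Preterm) (ρ : Env) : Monotone fun v =>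
    ap (full r (push X (Q (wt (semc X)) (tr (wt (semc X)) v)) ρ)) v :=
  fun _ _ hv => ap_raw_lam_aux (raw_mono r) (fun _ _ => le_rfl) hv

theorem ap_raw_lam_tr (X : TyClass) (r : Preterm) (ρ : Env) (v : Dom) :
    ap (raw (.lam X r) ρ) v = ap (full r (push X (Q (wt (semc X))
      (tr (wt (semc X)) (tr (W (.lam X r) - 1) v))) ρ)) (tr (W (.lam X r) - 1) v) :=
  ap_lam (monotone_lam_body X r ρ) _ _

theorem ap_raw_lam (X : TyClass) (r : Preterm) {ρ : Env} (h : LvEnv ρ) (v : Dom) :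
    ap (raw (.lam X r) ρ) v =
      ap (full r (push X (Q (wt (semc X)) (tr (wt (semc X)) v)) ρ)) v := by
  have h1 := lt_two_pow_mul (a := wt (semc X)) (W_pos r)
  have h2 := lt_two_pow_mul' (wt_pos (semc_ne_zero X)) (W_pos r)
  rw [ap_raw_lam_tr, tr_tr, W_lam, min_eq_left (by omega)]
  exact (lv_full r (h.push_Q X v)).ap_tr (by omega) v

/-! ## Invariance under the equivalence -/

theorem Eqv.atFull_eq {r s : Preterm} (h : Eqv r s) : atFull r = atFull s := by
  induction h with
  | symm _ ih => exact ih.symm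
  | curry r s t =>
    show Q _ = Q _
    rw [W, W, (Eqv.curry r s t).ok_and_typ.2]
  | @appL r s t h _ => show Q _ = Q _; rw [W, W, (Eqv.appL h).ok_and_typ.2]
  | @appR r s t h _ => show Q _ = Q _; rw [W, W, (Eqv.appR h).ok_and_typ.2]
  | @proj A r s h _ => show Q _ = Q _; rw [W, W, (Eqv.proj h).ok_and_typ.2]
  | _ => rfl

theorem Eqv.atHead_eq {r s : Preterm} (h : Eqv r s) : atHead r = atHead s := by
  induction h with
  | symm _ ih => exact ih.symm
  | comm r s => show Q _ = Q _; rw [W, W, (Eqv.comm r s).ok_and_typ.2]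
  | asso r s t => show Q _ = Q _; rw [W, W, (Eqv.asso r s t).ok_and_typ.2]
  | dist X r s => show Q _ = Q _; rw [W, W, (Eqv.dist X r s).ok_and_typ.2]
  | @lam X r s h _ => show Q _ = Q _; rw [W, W, (Eqv.lam (X := X) h).ok_and_typ.2]
  | @prodL r s t h _ => show Q _ = Q _; rw [W, W, (Eqv.prodL (t := t) h).ok_and_typ.2]
  | @prodR r s t h _ => show Q _ = Q _; rw [W, W, (Eqv.prodR (t := t) h).ok_and_typ.2]
  | _ => rfl

theorem raw_curry {r s t : Preterm} (hok : Ok (.app (.app r s) t)) {ρ : Env} (hρ : LvEnv ρ) :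
    raw (.app (.app r s) t) ρ = raw (.app r (.prod s t)) ρ := by
  have hW : W (.app r (.prod s t)) = W (.app (.app r s) t) := by
    rw [W, W, (Eqv.curry r s t).ok_and_typ.2]
  have hb : W (.app r s) = 2 ^ W t * W (.app (.app r s) t) := W_app hok.2.2
  have h1 := lt_two_pow_mul (a := W t) (W_pos (.app (.app r s) t))
  have h2 := lt_two_pow_mul' (W_pos t) (W_pos (.app (.app r s) t))
  refine ext_ap fun m => ?_
  show ap (App _ _ (App _ _ (hd r ρ) (full s ρ)) (full t ρ)) m =
    ap (App _ _ (hd r ρ) (full s ρ + full t ρ)) m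
  have ht : tr (W (.app r s) - 1) (full t ρ) = full t ρ :=
    (lv_full t hρ).mono (by omega)
  rw [ap_App, ap_App, ap_App, hW, tr_add, ht, tr_tr, min_eq_right (by omega), W_prod, add_ap,
    add_assoc (full s ρ)]
  ring

theorem Eqv.raw_eq {r s : Preterm} (h : Eqv r s) :
    Ok r → ∀ {ρ : Env}, LvEnv ρ → raw r ρ = raw s ρ := by
  induction h with
  | comm r s => intro _ ρ _; exact add_comm _ _
  | asso r s t => intro _ ρ _; exact add_assoc _ _ _
  | dist X r s =>
    intro _ ρ h
    refine ext_ap fun v => ?_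
    show _ = ap (raw (.lam X r) ρ + raw (.lam X s) ρ) v
    rw [add_ap, ap_raw_lam _ _ h, ap_raw_lam _ _ h, ap_raw_lam _ _ h]
    exact add_ap _ _ _
  | curry r s t => intro hok ρ h; exact raw_curry hok h
  | @symm r s h ih => intro hok ρ hρ; exact (ih (h.ok_and_typ.1.2 hok) hρ).symm
  | @lam X r s h ih =>
    intro hok ρ hρ
    refine ext_ap fun v => ?_
    rw [ap_raw_lam _ _ hρ, ap_raw_lam _ _ hρ, full, full, h.atFull_eq, ih hok (hρ.push_Q X v)]
  | @appL r s t h ih =>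
    intro hok ρ hρ
    rw [raw, raw, h.atHead_eq, ih hok.1 hρ, W, W, (Eqv.appL h).ok_and_typ.2]; rfl
  | @appR r s t h ih =>
    intro hok ρ hρ
    rw [raw, raw, h.atFull_eq, ih hok.2.1 hρ, W, W, W, W, (Eqv.appR h).ok_and_typ.2,
      h.ok_and_typ.2]
  | @prodL r s t h ih => intro hok ρ hρ; rw [raw, raw, h.atFull_eq, ih hok.1 hρ]
  | @prodR r s t h ih => intro hok ρ hρ; rw [raw, raw, h.atFull_eq, ih hok.2 hρ]
  | @proj A r s h ih => intro hok ρ hρ; rw [raw, raw, h.atHead_eq, ih hok.1 hρ]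

theorem Eqv.full_eq {r s : Preterm} (h : Eqv r s) (hok : Ok r) {ρ : Env} (hρ : LvEnv ρ) :
    full r ρ = full s ρ := by
  rw [full, full, h.atFull_eq, h.raw_eq hok hρ]

/-! ## Renaming and substitution -/

theorem atFull_rename (θ : TyClass → ℕ → ℕ) (r : Preterm) : atFull (rename θ r) = atFull r := by
  have h := W_rename θ r
  cases r <;> first | rfl | exact congrArg Q h

theorem atHead_rename (θ : TyClass → ℕ → ℕ) (r : Preterm) : atHead (rename θ r) = atHead r := by
  have h := W_rename θ r
  cases r <;> first | rfl | exact congrArg Q h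

theorem push_upRen (X : TyClass) (d : Dom) (ρ : Env) (θ : TyClass → ℕ → ℕ) :
    (fun Y n => push X d ρ Y (upRen X θ Y n)) = push X d fun Y n => ρ Y (θ Y n) := by
  funext Y n
  unfold push upRen
  by_cases h : Y = X
  · cases n <;> simp [h]
  · simp [h]

theorem raw_rename (r : Preterm) : ∀ (θ : TyClass → ℕ → ℕ) (ρ : Env),
    raw (rename θ r) ρ = raw r fun X n => ρ X (θ X n) := by
  induction r with
  | var X n => intro θ ρ; rfl
  | lam X r ih =>
    intro θ ρ
    have h : W (.lam X (rename (upRen X θ) r)) = W (.lam X r) := by rw [W_lam, W_lam, W_rename]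
    simp only [rename, raw, ih, push_upRen, atFull_rename, h]
  | app r s ih1 ih2 =>
    intro θ ρ
    have h : W (.app (rename θ r) (rename θ s)) = W (.app r s) := W_rename θ (.app r s)
    simp only [rename, raw, ih1, ih2, atFull_rename, atHead_rename, h, W_rename]
  | prod r s ih1 ih2 => intro θ ρ; simp only [rename, raw, ih1, ih2, atFull_rename]
  | proj A r ih => intro θ ρ; simp only [rename, raw, ih, atHead_rename]

theorem raw_shift (X : TyClass) (d : Dom) (ρ : Env) (r : Preterm) :
    raw (shift X r) (push X d ρ) = raw r ρ := by
  rw [shift, raw_rename]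
  congr 1
  funext Y n
  unfold push
  by_cases h : Y = X <;> simp [h]

theorem full_shift (X : TyClass) (d : Dom) (ρ : Env) (r : Preterm) :
    full (shift X r) (push X d ρ) = full r ρ := by
  rw [full, full, raw_shift, shift, atFull_rename]

theorem hd_shift (X : TyClass) (d : Dom) (ρ : Env) (r : Preterm) :
    hd (shift X r) (push X d ρ) = hd r ρ := by
  rw [hd, hd, raw_shift, shift, atHead_rename]

/-- The valuation `e` bounds the substitution `σ` under the valuation `ρ`. -/
def Bounds (σ : TyClass → ℕ → Preterm) (ρ e : Env) : Prop :=
  ∀ X n, hd (σ X n) ρ ≤ e X n ∧ full (σ X n) ρ ≤ Q (wt (semc X)) (e X n)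

theorem Bounds.up {σ : TyClass → ℕ → Preterm} {ρ e : Env} (h : Bounds σ ρ e) (X : TyClass)
    (d : Dom) : Bounds (Preterm.up X σ) (push X d ρ) (push X d e) := by
  intro Y n
  by_cases hY : Y = X
  · subst hY
    cases n with
    | zero => simp [Preterm.up, push, hd, full, atHead, atFull, raw, W, typ]
    | succ k =>
      have := h Y k
      simpa [Preterm.up, hd_shift, full_shift, push] using this
  · have := h Y n
    simpa [Preterm.up, hd_shift, full_shift, push, hY] using this

theorem subst_le (r : Preterm) : ∀ {σ : TyClass → ℕ → Preterm} {ρ e : Env}, Ok r → OkSubst σ →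
    Bounds σ ρ e → hd (subst σ r) ρ ≤ hd r e ∧ full (subst σ r) ρ ≤ full r e := by
  induction r with
  | var X n => intro σ ρ e _ _ h; exact h X n
  | lam X r ih =>
    intro σ ρ e hr hσ h
    have hW : W (.lam X (subst (Preterm.up X σ) r)) = W (.lam X r) := by
      rw [W_lam, W_lam, W, ((hσ.up X).ok_and_typ r hr).2, W]
    have key : raw (subst σ (.lam X r)) ρ ≤ raw (.lam X r) e :=
      lam_le_lam (monotone_lam_body X (subst (Preterm.up X σ) r) ρ) (monotone_lam_body X r e)
        (by rw [hW]) fun v => ap_mono (ih hr (hσ.up X) (h.up X _)).2 le_rfl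
    exact ⟨Q_le_Q hW.le key, key⟩
  | app r s ih1 ih2 =>
    intro σ ρ e hok hσ h
    have hW : W (subst σ (.app r s)) = W (.app r s) := by
      rw [W, (hσ.ok_and_typ _ hok).2, W]
    have hs : W (subst σ s) = W s := by rw [W, (hσ.ok_and_typ _ hok.2.1).2, W]
    have key : raw (subst σ (.app r s)) ρ ≤ raw (.app r s) e :=
      App_mono hW.le hs.le (ih1 hok.1 hσ h).1 (ih2 hok.2.1 hσ h).2
    exact ⟨key, Q_le_Q hW.le key⟩
  | prod r s ih1 ih2 =>
    intro σ ρ e hok hσ h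
    have hW : W (subst σ (.prod r s)) = W (.prod r s) := by
      rw [W, (hσ.ok_and_typ _ hok).2, W]
    have key : raw (subst σ (.prod r s)) ρ ≤ raw (.prod r s) e :=
      add_le_add' (ih1 hok.1 hσ h).2 (ih2 hok.2 hσ h).2
    exact ⟨Q_le_Q hW.le key, key⟩
  | proj A r ih =>
    intro σ ρ e hok hσ h
    have key : raw (subst σ (.proj A r)) ρ ≤ raw (.proj A r) e :=
      Pr_mono _ (ih hok.1 hσ h).1
    exact ⟨key, Q_mono _ key⟩

theorem full_inst_le {X : TyClass} {r s : Preterm} (hr : Ok r) (hs : Ok s) (hX : typ s = semc X)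
    (ρ : Env) : full (inst X s r) ρ ≤ full r (push X (Q (wt (semc X)) (full s ρ)) ρ) := by
  rw [inst_eq]
  refine (subst_le r hr (okSubst_single hs hX) ?_).2
  have hvar : ∀ Y n, hd (.var Y n) ρ ≤ ρ Y n ∧
      full (.var Y n) ρ ≤ Q (wt (semc Y)) (ρ Y n) := fun Y n => ⟨le_rfl, le_rfl⟩
  intro Y n
  by_cases hY : Y = X
  · subst hY
    cases n with
    | zero =>
      simp only [single, push, if_true]
      have hW : W s = wt (semc Y) := by rw [W, hX]
      rw [← hW]
      exact ⟨(atHead_le_Q _ _).trans (Q_mono _ (le_atFull _ _)),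
        (le_Q _ _).trans (le_Q _ _)⟩
    | succ k => simpa only [single, push, if_true] using hvar Y k
  · simpa only [single, push, hY, if_false] using hvar Y n

/-! ## Reduction decreases the interpretation -/

theorem decrease_beta {X : TyClass} {r s : Preterm} (hok : Ok (.app (.lam X r) s))
    (hX : typ s = semc X) {ρ : Env} (hρ : LvEnv ρ) :
    SLt (Q (W (.app (.lam X r) s)) (raw (inst X s r) ρ)) (raw (.app (.lam X r) s) ρ) := by
  obtain ⟨hr, hs, hp⟩ := hok
  have hW : W (inst X s r) = W (.app (.lam X r) s) := by
    rw [W, W, inst_eq, ((okSubst_single hs hX).ok_and_typ r hr).2, typ, typ, hX, map_add_map_sub]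
  refine beta_slt_App (n := W (.lam X r)) (F := raw (.lam X r) ρ) (W_pos s) (W_pos _) (W_app hp)
    (lv_full s hρ) (hW ▸ lv_raw _ hρ) fun x y hx hy => ?_
  rw [ap_raw_lam X r hρ]
  have hG : raw (inst X s r) ρ ≤ full (inst X s r) ρ := le_atFull _ _
  refine ap_mono (hG.trans ((full_inst_le (r := r) hr hs hX ρ).trans (full_mono r ?_))) hy
  refine push_mono (Q_mono _ ?_) fun _ _ => le_rfl
  have hlv : Lv (wt (semc X)) (full s ρ) := hX ▸ lv_full s hρ
  calc full s ρ = tr (wt (semc X)) (full s ρ) := hlv.symm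
    _ ≤ _ := tr_mono _ hx

theorem HeadRed.decrease {r s : Preterm} (h : HeadRed r s) (hok : Ok r) {ρ : Env}
    (hρ : LvEnv ρ) : SLt (hd s ρ) (hd r ρ) ∧ SLt (full s ρ) (full r ρ) := by
  have hW : W s = W r := by rw [W, (h.ok_and_typ hok).2, W]
  cases h with
  | @beta A r s hs =>
    have key := decrease_beta hok hs.ok_and_typ.2 hρ
    rw [← hW] at key
    exact ⟨key.of_le (atHead_le_Q _ _), (key.of_le (atFull_le_Q _ _)).trans_le (le_Q _ _)⟩
  | @proj A _ t ht =>
    have ha : wt (sem A) = W s := hW.symm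
    have key : SLt (Q (W s) (raw s ρ)) (raw (.proj A (.prod s t)) ρ) := by
      show SLt _ (Pr (wt (sem A)) (Q (W (.prod s t)) (full s ρ + full t ρ)))
      rw [ha]
      exact slt_Pr (W_pos s) (by rw [W_prod]; omega) (lv_raw s hρ)
        ((le_atFull s _).trans (le_add_right' _ _))
    exact ⟨key.of_le (atHead_le_Q _ _), (key.of_le (atFull_le_Q _ _)).trans_le (le_Q _ _)⟩
  | zeta r s t =>
    obtain ⟨⟨hr, hs⟩, ht, hp⟩ := hok
    simp only [typ, Multiset.mem_add] at hp
    have h1 : W r = 2 ^ W t * W (.app r t) := W_app fun p h => hp p (.inl h)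
    have h2 : W s = 2 ^ W t * W (.app s t) := W_app fun p h => hp p (.inr h)
    have e1 : hd r ρ ≤ Q (2 ^ W t * W (.app r t)) (full r ρ + full s ρ) := by
      rw [← h1]
      exact (atHead_le_Q _ _).trans (Q_mono _ ((le_atFull r _).trans (le_add_right' _ _)))
    have e2 : hd s ρ ≤ Q (2 ^ W t * W (.app s t)) (full r ρ + full s ρ) := by
      rw [← h2]
      exact (atHead_le_Q _ _).trans (Q_mono _ ((le_atFull s _).trans (le_add_left' _ _)))
    rw [W_prod] at hW
    constructor
    · have key := zeta_slt_App (W_pos (.app r t)) (W_pos (.app s t)) (W_pos t) (lv_full t hρ) e1 e2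
      rw [← h1, ← h2, hW, ← W_prod] at key
      have h3 : W (.prod (.app r t) (.app s t)) = W (.app (.prod r s) t) := by rw [W_prod, hW]
      show SLt (Q (W (.prod (.app r t) (.app s t))) _) _
      rw [h3]
      exact key
    · have h1' : W r ≤ W (.prod r s) := by rw [W_prod]; omega
      have h2' : W s ≤ W (.prod r s) := by rw [W_prod]; omega
      have key := zeta_slt_Q (c := W t) (t := full t ρ) (W_pos (.app r t)) (W_pos (.app s t))
        (e1.trans (Q_le_Q (h1 ▸ h1') le_rfl)) (e2.trans (Q_le_Q (h2 ▸ h2') le_rfl))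
      rw [hW] at key
      exact key

theorem Preterm.IsElimOrVar.atFull_eq {r : Preterm} (h : IsElimOrVar r) : atFull r = Q (W r) := by
  cases h <;> rfl

theorem Preterm.IsElimOrVar.atHead_eq {r : Preterm} (h : IsElimOrVar r) : atHead r = id := by
  cases h <;> rfl

theorem HeadExp.decrease {r s : Preterm} (h : HeadExp r s) {ρ : Env} :
    SLt (full s ρ) (full r ρ) := by
  cases h with
  | @eta A B r ht he =>
    have htyp := ht.ok_and_typ.2
    have hb : W (.app (shift (cls A) r) (.var (cls A) 0)) = wt (sem B) := by
      simp only [W, typ, typ_shift, htyp, sem, semc_cls, map_add_map_sub]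
    have hn : W r = 2 ^ wt (sem A) * wt (sem B) := by rw [W, htyp, sem, wt_map_add]
    have hn' : W (.lam (cls A) (.app (shift (cls A) r) (.var (cls A) 0))) = W r := by
      rw [W_lam, hb, hn, semc_cls]
    intro v
    have key := eta_lt_Q (wt_pos (sem_ne_zero A)) (wt_pos (sem_ne_zero B)) hn (raw r ρ) v
    rw [full, full, he.atFull_eq]
    refine lt_of_eq_of_lt ?_ key
    show ap (raw _ ρ) v = _
    rw [ap_raw_lam_tr, hn', semc_cls]
    show ap (Q (W _) (App (W _) (W (.var (cls A) 0)) (hd (shift _ r) _) (full (.var _ 0) _))) _ = _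
    rw [hb, hd_shift, hd, he.atHead_eq]
    show ap (Q _ (App _ _ _ (Q (wt (sem A)) (push (cls A) _ ρ (cls A) 0)))) _ = _
    simp only [push, if_true]
    rfl
  | @delta A B r ht he =>
    have hn : W r = wt (sem A) + wt (sem B) := by rw [W, ht.ok_and_typ.2, sem, wt_add]
    have key := delta_slt_Q (wt_pos (sem_ne_zero A)) (wt_pos (sem_ne_zero B)) (raw r ρ)
    rw [← hn] at key
    rw [full.eq_def r, he.atFull_eq]
    show SLt (Q _ (Pr _ (atHead r _)) + Q _ (Pr _ (atHead r _))) _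
    rw [he.atHead_eq]
    exact key

theorem decrease_of_raw {r s : Preterm} {ρ : Env} (h : SLt (raw s ρ) (raw r ρ))
    (hF : atFull s = atFull r) (hH : atHead s = atHead r) :
    SLt (hd s ρ) (hd r ρ) ∧ SLt (full s ρ) (full r ρ) := by
  rw [hd, full, hF, hH]
  exact ⟨SLt.atHead r h, SLt.atFull r h⟩

mutual

theorem BasicRed.decrease {r s : Preterm} (h : BasicRed r s) (hok : Ok r) {ρ : Env}
    (hρ : LvEnv ρ) : SLt (hd s ρ) (hd r ρ) ∧ SLt (full s ρ) (full r ρ) := by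
  have hW : W s = W r := by rw [W, (h.ok_and_typ hok).2, W]
  cases h with
  | head h => exact h.decrease hok hρ
  | @lam X r s h =>
    refine decrease_of_raw (fun v => ?_) rfl (congrArg Q hW)
    rw [ap_raw_lam X _ hρ, ap_raw_lam X _ hρ]
    exact h.decrease hok (hρ.push_Q X v) v
  | @appL r s t h =>
    refine decrease_of_raw (fun m => ?_) (congrArg Q hW) rfl
    show ap (App _ _ (hd s ρ) _) m < ap (App _ _ (hd r ρ) _) m
    rw [hW, ap_App, ap_App]
    have := (h.decrease hok.1 hρ).1 (atFull t (raw t ρ) + tr (W (.app r t) - 1) m)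
    omega
  | @appR r s t h =>
    refine decrease_of_raw (fun m => ?_) (congrArg Q hW) rfl
    show ap (App _ _ (hd t ρ) (full s ρ)) m < ap (App _ _ (hd t ρ) (full r ρ)) m
    have hs : W s = W r := by rw [W, (h.ok_and_typ hok.2.1).2, W]
    have h1 := h.decrease hok.2.1 hρ
    have h2 := h1 0
    have h3 := ap_mono (le_refl (hd t ρ))
      (add_le_add' h1.le (le_refl (tr (W (.app t r) - 1) m)))
    rw [hW, hs, ap_App, ap_App]
    omega
  | @prodL r s t h =>
    refine decrease_of_raw (fun m => ?_) rfl (congrArg Q hW)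
    show ap (full s ρ + full t ρ) m < ap (full r ρ + full t ρ) m
    have := h.decrease hok.1 hρ m
    rw [add_ap, add_ap]
    omega
  | @prodR r s t h =>
    refine decrease_of_raw (fun m => ?_) rfl (congrArg Q hW)
    show ap (full t ρ + full s ρ) m < ap (full t ρ + full r ρ) m
    have := h.decrease hok.2 hρ m
    rw [add_ap, add_ap]
    omega
  | @proj A r s h =>
    refine decrease_of_raw (fun m => ?_) rfl rfl
    show ap (Pr _ (hd s ρ)) m < ap (Pr _ (hd r ρ)) m
    rw [ap_Pr, ap_Pr]
    exact Nat.succ_lt_succ ((h.decrease hok.1 hρ).1 _)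

theorem Red.decrease {r s : Preterm} (h : Red r s) (hok : Ok r) {ρ : Env}
    (hρ : LvEnv ρ) : SLt (full s ρ) (full r ρ) := by
  cases h with
  | exp h => exact h.decrease
  | basic h => exact (h.decrease hok hρ).2

end

/-! ## Strong normalisation -/

theorem EqvStar.ok_and_full_eq {r s : Preterm} (h : EqvStar r s) (hok : Ok r) {ρ : Env}
    (hρ : LvEnv ρ) : Ok s ∧ full s ρ = full r ρ := by
  induction h with
  | refl => exact ⟨hok, rfl⟩
  | tail _ h ih => exact ⟨h.ok_and_typ.1.1 ih.1, (h.full_eq ih.1 hρ).symm.trans ih.2⟩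

theorem RedMod.ok_and_decrease {r s : Preterm} (h : RedMod r s) (hok : Ok r) {ρ : Env}
    (hρ : LvEnv ρ) : Ok s ∧ SLt (full s ρ) (full r ρ) := by
  obtain ⟨r', s', h1, h2, h3⟩ := h
  obtain ⟨hr', e1⟩ := h1.ok_and_full_eq hok hρ
  obtain ⟨hs, e2⟩ := h3.ok_and_full_eq (h2.ok_and_typ hr').1 hρ
  refine ⟨hs, ?_⟩
  rw [e2, ← e1]
  exact h2.decrease hr' hρ

theorem sn_of_ok {r : Preterm} (hok : Ok r) : SN r := by
  have hρ : LvEnv fun _ _ => 0 := fun _ _ => lv_zero _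
  induction h : ap (full r fun _ _ => 0) 0 using Nat.strong_induction_on generalizing r with
  | _ n ih =>
    refine ⟨_, fun s hs => ?_⟩
    obtain ⟨h1, h2⟩ := RedMod.ok_and_decrease hs hok hρ
    exact ih _ (h ▸ h2 0) h1 rfl

end SystemI

end

theorem theorem4 (r : SystemI.Preterm) (A : SystemI.Ty) (h : SystemI.HasType r A) :
    SystemI.SN r :=
  SystemI.sn_of_ok h.ok_and_typ.1
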